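/- **Setting.** Let $(M,g)$ be a smooth compact Riemannian manifold with boundary, of dimension $n\ge 1$. Let $A\subset M$ be a closed set with $A=\overline{\operatorname{int}A}$ and $A\cap\partial M\neq\emptyset$, whose boundary $\partial A$ (interior and boundary are taken in the topology of $M$) is $C^1$ and meets $\partial M$ orthogonally: every $x\in\partial A$ has a neighbourhood $U$ in $M$ and a $C^1$ function $\rho:U\to\mathbb R$ with $A\cap U=\{\rho\ge 0\}$, $\rho(x)=0$, $d\rho_x\ne0$, and $d\rho_x(\nu)=0$ for the normals $\nu$ of $\partial M$ if $x\in\partial M$. Put $$R=\partial M\cap\operatorname{int}A,\qquad E=\partial A\setminus\partial M,\qquad C=\partial A\cap\partial M .$$ **The double.** $\tilde A$ is the quotient of two disjoint copies of $A$ in which the two copies of each point of $\bar R$ are identified; $\pi:\tilde A\to A$ is the natural projection, and $\tilde f=f\circ\pi$ for $f:A\to\mathbb R$. Its boundary is $\pi^{-1}(E\cup C)$. Its differentiable structure is given off $\pi^{-1}(\partial M)$ by that of $M$, and at points of $\pi^{-1}(\partial M)$ by boundary normal coordinates of $M$ in which the sign of the normal coordinate is changed on the second copy; it carries the metric $\tilde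 g=\pi^*g$, which is smooth up to $\pi^{-1}(\partial M)$ on each copy. $\Gamma(\tilde A)$ is the set of unit speed geodesics $\varphi:[0,L]\to\tilde A$, $L>0$, with $\varphi(0),\varphi(L)\in\partial\tilde A$. Here a geodesic is a $C^1$ curve such that each time has a one-sided neighbourhood, on the left and on the right, during which the curve stays in one copy of $A$ and satisfies the geodesic equation there. **Broken rays.** $\Gamma_E(A)$ is the set of unit speed, piecewise geodesic curves $\gamma:[0,L]\to A$, $L>0$ (finitely many pieces, each satisfying the geodesic equation of $M$), with $\gamma(0),\gamma(L)\in E\cup C$, such that at each time $t\in(0,L)$ the velocity is continuous if $\gamma(t)\notin\partial M\cup\partial A$, and otherwise is reflected by the law that the angle of incidence equals the angle of reflection: in the hyperplane $T\partial M$ if $\gamma(t)\in R$, in $T\partial A$ if $\gamma(t)\in E$, and in both if $\gamma(t)\in C$. **Transforms.** For $h,f:\tilde A\to\mathbb R$ and $\varphi\in\Gamma(\tilde A)$, respectively $h,f:A\to\mathbb R$ and $\gamma\in\Gamma_E(A)$, put $$I_hf(\varphi)=\int_0^L f(\varphi(t))\,e^{\int_0^t h(\varphi(s))\,ds}\,dt,\qquad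 G_hf(\gamma)=\int_0^L f(\gamma(t))\,e^{\int_0^t h(\gamma(s))\,ds}\,dt$$ (an integral that does not exist is given the value $0$). **Theorem.** Let $F$ and $H$ be any classes of functions $A\to\mathbb R$, and let $\tilde F=\{\tilde f: f\in F\}$, $\tilde H=\{\tilde h:h\in H\}$. 1. (Unknown attenuation.) If the map $(\tilde h,\tilde f)\mapsto I_{\tilde h}\tilde f\in\mathbb R^{\Gamma(\tilde A)}$ is injective on $\tilde H\times\tilde F$, then the map $(h,f)\mapsto G_hf\in\mathbb R^{\Gamma_E(A)}$ is injective on $H\times F$. 2. (Known attenuation.) For each $h\in H$: if $\tilde f\mapsto I_{\tilde h}\tilde f$ is injective on $\tilde F$, then $f\mapsto G_hf$ is injective on $F$. -/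

import Mathlib

open Set Filter Topology MeasureTheory Bundle
open scoped Manifold ContDiff

noncomputable section

namespace BrokenRay

/-- The coordinate space `ℝⁿ`; coordinate `0` is the one that is nonnegative in the half space
on which a manifold with boundary is modelled. -/
abbrev Coord (n : ℕ) : Type := EuclideanSpace ℝ (Fin n)

/-- A smooth Riemannian metric on an `n`-dimensional manifold with boundary `M`. -/
abbrev RMetric (n : ℕ) [NeZero n] (M : Type*) [TopologicalSpace M]
    [ChartedSpace (EuclideanHalfSpace n) M] [IsManifold (𝓡∂ n) ∞ M] : Type _ :=
  ContMDiffRiemannianMetric (𝓡∂ n) ∞ (Coord n) (fun x : M => TangentSpace (𝓡∂ n) x)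

section Geometry

variable {n : ℕ} [NeZero n] {M : Type*} [TopologicalSpace M]
  [ChartedSpace (EuclideanHalfSpace n) M] [IsManifold (𝓡∂ n) ∞ M]

/-! ### The metric in coordinates and geodesics of `M` -/

/-- The metric in the chart `e`, at the coordinate point `y`, on the coordinate vectors `u`, `w`:
the number `∑ g_{jk}(y) u^j w^k`. -/
def metricInChart (g : RMetric n M) (e : OpenPartialHomeomorph M (EuclideanHalfSpace n))
    (y u w : Coord n) : ℝ :=
  g.inner ((e.extend (𝓡∂ n)).symm y)
    (mfderivWithin 𝓘(ℝ, Coord n) (𝓡∂ n) (e.extend (𝓡∂ n)).symm (range (𝓡∂ n)) y u)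
    (mfderivWithin 𝓘(ℝ, Coord n) (𝓡∂ n) (e.extend (𝓡∂ n)).symm (range (𝓡∂ n)) y w)

/-- The derivative at `y`, in the direction `z`, of the metric coefficients in the chart `e`:
the number `∑ ∂_l g_{jk}(y) z^l u^j w^k` (one-sided at the boundary). -/
def metricDerivInChart (g : RMetric n M) (e : OpenPartialHomeomorph M (EuclideanHalfSpace n))
    (y z u w : Coord n) : ℝ :=
  fderivWithin ℝ (fun y' => metricInChart g e y' u w) (range (𝓡∂ n)) y z

/-- The velocity at time `t` of a curve in `M`, computed along the set of times `s`. -/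
def velocity (c : ℝ → M) (s : Set ℝ) (t : ℝ) : TangentSpace (𝓡∂ n) (c t) :=
  mfderivWithin 𝓘(ℝ, ℝ) (𝓡∂ n) c s t (1 : ℝ)

/-- The curve `c` is a unit speed geodesic of `(M, g)` on the (nondegenerate) interval `s`: it is
`C²` on `s`, and in coordinates
`∑ g_{jk} x''^j w^k + ∑ ∂_l g_{jk} x'^l x'^j w^k - (1/2) ∑ ∂_l g_{jk} w^l x'^j x'^k = 0`
for all `w`, which is the geodesic equation `x''^i + Γ^i_{jk} x'^j x'^k = 0` with its index
lowered. The metric being smooth up to `∂M`, this also makes sense where `c` meets `∂M`. -/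
def IsGeodesicOn (g : RMetric n M) (c : ℝ → M) (s : Set ℝ) : Prop :=
  ContMDiffOn 𝓘(ℝ, ℝ) (𝓡∂ n) 2 c s ∧
  ∀ t ∈ s,
    g.inner (c t) (velocity (n := n) c s t) (velocity (n := n) c s t) = 1 ∧
    let e := chartAt (EuclideanHalfSpace n) (c t)
    let x : ℝ → Coord n := fun r => e.extend (𝓡∂ n) (c r)
    let v := derivWithin x s t
    let a := derivWithin (derivWithin x s) s t
    ∀ w : Coord n,
      metricInChart g e (x t) a w + metricDerivInChart g e (x t) v v w
        - (1 / 2) * metricDerivInChart g e (x t) w v v = 0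

/-! ### Hyperplanes, the reflection law -/

/-- `v` is tangent to `∂M` at the boundary point `x`. -/
def IsTangentToBoundary (x : M) (v : TangentSpace (𝓡∂ n) x) : Prop :=
  let u : Coord n := mfderiv (𝓡∂ n) 𝓘(ℝ, Coord n) (extChartAt (𝓡∂ n) x) x v
  u 0 = 0

/-- `ρ` is a local `C¹` defining function of the set `A` at its boundary point `x`. -/
structure IsDefiningFunctionAt (A : Set M) (ρ : M → ℝ) (x : M) : Prop where
  contMDiffAt : ContMDiffAt (𝓡∂ n) 𝓘(ℝ, ℝ) 1 ρ x
  eq_zero : ρ x = 0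
  mfderiv_ne_zero : mfderiv (𝓡∂ n) 𝓘(ℝ, ℝ) ρ x ≠ 0
  mem_iff : ∀ᶠ y in 𝓝 x, y ∈ A ↔ 0 ≤ ρ y

/-- `v` lies in the kernel of `dρ` at `x`, that is, it is tangent to the level set of `ρ`. -/
def IsTangentToLevel (ρ : M → ℝ) (x : M) (v : TangentSpace (𝓡∂ n) x) : Prop :=
  (mfderiv (𝓡∂ n) 𝓘(ℝ, ℝ) ρ x v : ℝ) = 0

/-- The law of reflection in the hyperplane `T ⊆ T_x M`: the component of the velocity tangent
to `T` is kept and the component normal to `T` changes its sign. -/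
def ReflectionLaw (g : RMetric n M) {x : M} (T : TangentSpace (𝓡∂ n) x → Prop)
    (vIn vOut : TangentSpace (𝓡∂ n) x) : Prop :=
  T (vIn + vOut) ∧ ∀ w, T w → g.inner x (vOut - vIn) w = 0

/-! ### The set `A` -/

/-- The assumptions on `A`: it is the closure of its interior, it meets `∂M`, and its boundary
(in the topology of `M`) is `C¹` and meets `∂M` orthogonally: the normal of `∂M` is tangent
to `∂A`. -/
structure IsReflectable (g : RMetric n M) (A : Set M) : Prop where
  isClosed : IsClosed A
  eq_closure_interior : A = closure (interior A)
  meets_boundary : (A ∩ (𝓡∂ n).boundary M).Nonempty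
  smooth_orthogonal : ∀ x ∈ frontier A, ∃ ρ : M → ℝ, IsDefiningFunctionAt (n := n) A ρ x ∧
    (x ∈ (𝓡∂ n).boundary M → ∀ ν : TangentSpace (𝓡∂ n) x,
      (∀ w, IsTangentToBoundary x w → g.inner x ν w = 0) → IsTangentToLevel ρ x ν)

/-- The reflecting part `R = ∂M ∩ int A` (interior in the topology of `M`). -/
def reflector (n : ℕ) [NeZero n] {M : Type*} [TopologicalSpace M]
    [ChartedSpace (EuclideanHalfSpace n) M] (A : Set M) : Set M :=
  (𝓡∂ n).boundary M ∩ interior A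

/-- The set of tomography `E = ∂A \ ∂M`. -/
def tomographySet (n : ℕ) [NeZero n] {M : Type*} [TopologicalSpace M]
    [ChartedSpace (EuclideanHalfSpace n) M] (A : Set M) : Set M :=
  frontier A \ (𝓡∂ n).boundary M

/-- The corner set `C = ∂M ∩ ∂A`. -/
def cornerSet (n : ℕ) [NeZero n] {M : Type*} [TopologicalSpace M]
    [ChartedSpace (EuclideanHalfSpace n) M] (A : Set M) : Set M :=
  (𝓡∂ n).boundary M ∩ frontier A

/-! ### Broken rays -/

open Classical in
/-- The unit speed curve `c : [0, L] → A` is a broken ray with endpoints in `E ∪ C`. It is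
piecewise geodesic (every time has a one-sided neighbourhood, on either side, on which `c` is a
geodesic; by compactness there are finitely many pieces). At each intermediate time the incoming
velocity is reflected in `T∂M` if the point is on `∂M`, and in `T∂A` if the point is on `∂A`
(in both at a corner), and is unchanged if it is on neither. The values of `c` outside `[0, L]`
are irrelevant. -/
structure IsBrokenRay (g : RMetric n M) (A : Set M) (L : ℝ) (c : ℝ → A) : Prop where
  pos : 0 < L
  start_mem : (c 0 : M) ∈ tomographySet n A ∪ cornerSet n A
  end_mem : (c L : M) ∈ tomographySet n A ∪ cornerSet n A
  geodesic_right : ∀ t ∈ Ico 0 L, ∃ ε > 0, t + ε ≤ L ∧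
    IsGeodesicOn g (fun r => (c r : M)) (Icc t (t + ε))
  geodesic_left : ∀ t ∈ Ioc 0 L, ∃ ε > 0, 0 ≤ t - ε ∧
    IsGeodesicOn g (fun r => (c r : M)) (Icc (t - ε) t)
  reflection : ∀ t ∈ Ioo 0 L, ∃ u : TangentSpace (𝓡∂ n) (c t : M),
    (if (c t : M) ∈ (𝓡∂ n).boundary M
      then ReflectionLaw g (IsTangentToBoundary (c t : M))
        (velocity (n := n) (fun r => (c r : M)) (Iic t) t) u
      else u = velocity (n := n) (fun r => (c r : M)) (Iic t) t) ∧
    (if (c t : M) ∈ frontier A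
      then ∃ ρ : M → ℝ, IsDefiningFunctionAt (n := n) A ρ (c t : M) ∧
        ReflectionLaw g (IsTangentToLevel ρ (c t : M))
          u (velocity (n := n) (fun r => (c r : M)) (Ici t) t)
      else velocity (n := n) (fun r => (c r : M)) (Ici t) t = u)

/-! ### The doubled manifold -/

/-- Two copies of `A`, labelled by `false` and `true`, are glued along the closure of `R`. -/
def doubleSetoid (n : ℕ) [NeZero n] {M : Type*} [TopologicalSpace M]
    [ChartedSpace (EuclideanHalfSpace n) M] (A : Set M) : Setoid (Bool × A) where
  r p q := p.2 = q.2 ∧ (p.1 = q.1 ∨ (p.2 : M) ∈ closure (reflector n A))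
  iseqv :=
    { refl := fun _ => ⟨rfl, Or.inl rfl⟩
      symm := by
        rintro ⟨i, x⟩ ⟨j, y⟩ ⟨h, h'⟩
        dsimp only at h h'
        subst h
        exact ⟨rfl, h'.imp Eq.symm id⟩
      trans := by
        rintro ⟨i, x⟩ ⟨j, y⟩ ⟨k, z⟩ ⟨h, h'⟩ ⟨l, l'⟩
        dsimp only at h h' l l'
        subst h
        subst l
        refine ⟨rfl, ?_⟩
        rcases h' with h' | h'
        · rcases l' with l' | l'
          · exact Or.inl (h'.trans l')
          · exact Or.inr l'
        · exact Or.inr h' }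

/-- The double `Ã` of `A`. -/
def Double (n : ℕ) [NeZero n] {M : Type*} [TopologicalSpace M]
    [ChartedSpace (EuclideanHalfSpace n) M] (A : Set M) : Type _ :=
  Quotient (doubleSetoid n A)

instance instTopologicalSpaceDouble (A : Set M) : TopologicalSpace (Double n A) :=
  inferInstanceAs (TopologicalSpace (Quotient (doubleSetoid n A)))

/-- The natural injections of the two copies into the double. -/
def copy (n : ℕ) [NeZero n] {M : Type*} [TopologicalSpace M]
    [ChartedSpace (EuclideanHalfSpace n) M] (A : Set M) (i : Bool) (x : A) : Double n A :=
  Quotient.mk (doubleSetoid n A) (i, x)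

/-- The natural projection `π : Ã → A`. -/
def proj (n : ℕ) [NeZero n] {M : Type*} [TopologicalSpace M]
    [ChartedSpace (EuclideanHalfSpace n) M] (A : Set M) : Double n A → A :=
  Quotient.lift (fun p : Bool × A => p.2) (fun _ _ h => h.1)

/-- The boundary of the double: the two copies of `E`, and the common image of `C`. -/
def doubleBoundary (n : ℕ) [NeZero n] {M : Type*} [TopologicalSpace M]
    [ChartedSpace (EuclideanHalfSpace n) M] (A : Set M) : Set (Double n A) :=
  {q | (proj n A q : M) ∈ tomographySet n A ∪ cornerSet n A}

/-- `e` is a system of boundary normal coordinates: in these coordinates `g_{00} = 1` and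
`g_{0j} = 0` for `j ≠ 0`, where the coordinate `0` is nonnegative and vanishes exactly on `∂M`. -/
def IsBoundaryNormalChart (g : RMetric n M)
    (e : OpenPartialHomeomorph M (EuclideanHalfSpace n)) : Prop :=
  e ∈ IsManifold.maximalAtlas (𝓡∂ n) ∞ M ∧
  ∀ y ∈ (e.extend (𝓡∂ n)).target, ∀ w : Coord n,
    metricInChart g e y (EuclideanSpace.single 0 1) w = w 0

open Classical in
/-- The coordinates on the double induced by boundary normal coordinates `e`: those of `e` on the
first copy, and those of `e` with the sign of the normal coordinate changed on the second one. -/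
def doubleCoord {A : Set M} (e : OpenPartialHomeomorph M (EuclideanHalfSpace n))
    (q : Double n A) : Coord n :=
  let y : Coord n := e.extend (𝓡∂ n) (proj n A q : M)
  if q ∈ range (copy n A true) then y - (2 * y 0) • EuclideanSpace.single 0 1 else y

/-- The curve `φ` in the double is `C¹` at time `t`: off `∂M` the projection `π` is a local
diffeomorphism and is used to read the curve in `M`; on the seam, where `π` is not smooth, the
curve is read in doubled boundary normal coordinates. -/
def IsC1At (g : RMetric n M) {A : Set M} (φ : ℝ → Double n A) (t : ℝ) : Prop :=
  ((proj n A (φ t) : M) ∉ (𝓡∂ n).boundary M →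
    ContMDiffAt 𝓘(ℝ, ℝ) (𝓡∂ n) 1 (fun r => (proj n A (φ r) : M)) t) ∧
  ((proj n A (φ t) : M) ∈ (𝓡∂ n).boundary M →
    ∃ e : OpenPartialHomeomorph M (EuclideanHalfSpace n),
      IsBoundaryNormalChart g e ∧ (proj n A (φ t) : M) ∈ e.source ∧
      ContDiffAt ℝ 1 (fun r => doubleCoord e (φ r)) t)

/-- On the set of times `s` the curve `φ` stays in one copy of `A` and is a unit speed geodesic
for the reflected metric `π^* g`, which is smooth up to the seam on each copy. -/
def IsGeodesicInCopy (g : RMetric n M) {A : Set M} (φ : ℝ → Double n A) (s : Set ℝ) : Prop :=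
  (∃ i : Bool, ∀ r ∈ s, φ r ∈ range (copy n A i)) ∧
  IsGeodesicOn g (fun r => (proj n A (φ r) : M)) s

/-- `φ : [0, L] → Ã` is a unit speed geodesic of the double, for the reflected metric, joining
two boundary points. The reflected metric is smooth on each copy up to the seam, but in general
only Lipschitz across the seam. Hence a geodesic is a `C¹` curve for the smooth structure of the
double such that to the left and to the right of each time it satisfies the geodesic equation
in one of the copies. The values of `φ` outside `[0, L]` are irrelevant. -/
structure IsDoubleGeodesic (g : RMetric n M) (A : Set M) (L : ℝ) (φ : ℝ → Double n A) : Prop where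
  pos : 0 < L
  continuousOn : ContinuousOn φ (Icc 0 L)
  start_mem : φ 0 ∈ doubleBoundary n A
  end_mem : φ L ∈ doubleBoundary n A
  geodesic_right : ∀ t ∈ Ico 0 L, ∃ ε > 0, t + ε ≤ L ∧ IsGeodesicInCopy g φ (Icc t (t + ε))
  geodesic_left : ∀ t ∈ Ioc 0 L, ∃ ε > 0, 0 ≤ t - ε ∧ IsGeodesicInCopy g φ (Icc (t - ε) t)
  c1 : ∀ t ∈ Ioo 0 L, IsC1At g φ t

/-! ### The transforms -/

/-- `∫_0^L f(c(t)) exp(∫_0^t h(c(s)) ds) dt`. -/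
def attenuatedIntegral {X : Type*} (h f : X → ℝ) (L : ℝ) (c : ℝ → X) : ℝ :=
  ∫ t in (0 : ℝ)..L, f (c t) * Real.exp (∫ s in (0 : ℝ)..t, h (c s))

/-- `Γ(Ã)`: the geodesics of the double joining boundary points, with their lengths. -/
def geodesics (g : RMetric n M) (A : Set M) : Set (ℝ × (ℝ → Double n A)) :=
  {p | IsDoubleGeodesic g A p.1 p.2}

/-- `Γ_E(A)`: the broken rays of `A`, with their lengths. -/
def brokenRays (g : RMetric n M) (A : Set M) : Set (ℝ × (ℝ → A)) :=
  {p | IsBrokenRay g A p.1 p.2}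

/-- The attenuated geodesic ray transform on the double. -/
def geodesicRayTransform (g : RMetric n M) (A : Set M) (h f : Double n A → ℝ) :
    geodesics g A → ℝ :=
  fun γ => attenuatedIntegral h f γ.1.1 γ.1.2

/-- The attenuated broken ray transform on `A`. -/
def brokenRayTransform (g : RMetric n M) (A : Set M) (h f : A → ℝ) : brokenRays g A → ℝ :=
  fun γ => attenuatedIntegral h f γ.1.1 γ.1.2

/-- The reflected function `π^* f`. -/
def reflect (n : ℕ) [NeZero n] {M : Type*} [TopologicalSpace M]
    [ChartedSpace (EuclideanHalfSpace n) M] {A : Set M} (f : A → ℝ) : Double n A → ℝ :=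
  f ∘ proj n A

/-- The reflected class of functions. -/
def reflectClass (n : ℕ) [NeZero n] {M : Type*} [TopologicalSpace M]
    [ChartedSpace (EuclideanHalfSpace n) M] {A : Set M} (F : Set (A → ℝ)) :
    Set (Double n A → ℝ) :=
  reflect n '' F

end Geometry

end BrokenRay

end

namespace BrokenRay

/-! ### One-sided minima -/

/-! Only one direction is needed: every geodesic φ of the double projects to a broken ray π ∘ φ
(`IsDoubleGeodesic.isBrokenRay_proj`). Since the transform of the reflected functions along φ is the
transform of the original functions along π ∘ φ, equal broken ray data give equal geodesic data, and
injectivity passes down because f ↦ f ∘ π is injective. No broken ray has to be lifted. The geodesic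
pieces project at once, so the content is the reflection law. On ∂M, the C¹ condition in doubled
normal coordinates says that the incoming and outgoing coordinate velocities agree up to a sign of
the normal component. The normal coordinate is minimal on ∂M, so the curve comes in with nonpositive
and leaves with nonnegative normal velocity; this makes the two velocities mirror images
(`mirror_of_flip_eq`, `reflectionLaw_boundary`). On ∂A, a defining function ρ is minimal along the
curve, so its one-sided derivatives are ≤ 0 and ≥ 0. They are equal: off ∂M by differentiability,
and at a corner because the velocity jumps along the normal of ∂M, which dρ kills by orthogonality.
Hence both vanish, and the reflection in T∂A is trivial. -/

theorem nonneg_of_hasDerivWithinAt_Ici {f : ℝ → ℝ} {f' t : ℝ}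
    (hf : HasDerivWithinAt f f' (Ici t) t) (hmin : ∀ᶠ r in 𝓝[≥] t, f t ≤ f r) : 0 ≤ f' := by
  have h := hasDerivWithinAt_iff_tendsto_slope' self_notMem_Ioi |>.1 hf.Ioi_of_Ici
  refine ge_of_tendsto h ?_
  filter_upwards [hmin.filter_mono (nhdsWithin_mono _ Ioi_subset_Ici_self),
    self_mem_nhdsWithin] with r hr hr'
  rw [slope_def_field]
  exact div_nonneg (sub_nonneg.2 hr) (sub_nonneg.2 (le_of_lt hr'))

theorem nonpos_of_hasDerivWithinAt_Iic {f : ℝ → ℝ} {f' t : ℝ}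
    (hf : HasDerivWithinAt f f' (Iic t) t) (hmin : ∀ᶠ r in 𝓝[≤] t, f t ≤ f r) : f' ≤ 0 := by
  have h := hasDerivWithinAt_iff_tendsto_slope' self_notMem_Iio |>.1 hf.Iio_of_Iic
  refine le_of_tendsto h ?_
  filter_upwards [hmin.filter_mono (nhdsWithin_mono _ Iio_subset_Iic_self),
    self_mem_nhdsWithin] with r hr hr'
  rw [slope_def_field]
  exact div_nonpos_of_nonneg_of_nonpos (sub_nonneg.2 hr) (sub_nonpos.2 (le_of_lt hr'))

section Charts

variable {n : ℕ} [NeZero n] {M : Type*} [TopologicalSpace M]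

/-! ### Charts and their derivatives -/

theorem extend_zero_nonneg (e : OpenPartialHomeomorph M (EuclideanHalfSpace n)) (x : M) :
    0 ≤ (e.extend (𝓡∂ n) x : Coord n) 0 := (e x).2

variable [ChartedSpace (EuclideanHalfSpace n) M]

/-- The differential at `x` of a function on `M` with values in a vector space. -/
noncomputable def differential {V : Type*} [NormedAddCommGroup V] [NormedSpace ℝ V] (f : M → V)
    (x : M) : TangentSpace (𝓡∂ n) x →L[ℝ] V :=
  mfderiv (𝓡∂ n) 𝓘(ℝ, V) f x

theorem mdifferentiableAt_extend {e : OpenPartialHomeomorph M (EuclideanHalfSpace n)}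
    (he : e ∈ IsManifold.maximalAtlas (𝓡∂ n) ∞ M) {x : M} (hx : x ∈ e.source) :
    MDifferentiableAt (𝓡∂ n) 𝓘(ℝ, Coord n) (e.extend (𝓡∂ n)) x :=
  (e.contMDiffAt_extend he hx).mdifferentiableAt (by simp)

theorem mdifferentiableWithinAt_extend_symm
    {e : OpenPartialHomeomorph M (EuclideanHalfSpace n)}
    (he : e ∈ IsManifold.maximalAtlas (𝓡∂ n) ∞ M) {x : M} (hx : x ∈ e.source) :
    MDifferentiableWithinAt 𝓘(ℝ, Coord n) (𝓡∂ n) (e.extend (𝓡∂ n)).symm (range (𝓡∂ n))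
      (e.extend (𝓡∂ n) x) := by
  have h := (contMDiffOn_extend_symm he).mdifferentiableOn (by simp)
    (e.extend (𝓡∂ n) x) (mem_image_of_mem _ (e.map_source hx))
  refine h.mono_of_mem_nhdsWithin ?_
  have := e.extend_target_mem_nhdsWithin (I := 𝓡∂ n) hx
  rwa [e.extend_target, ← (𝓡∂ n).image_eq] at this

/-- Chain rule for the identity, factored near `x` through the chart. It lets coordinate
computations be read back in the tangent space. -/
theorem mfderivWithin_extend_symm_mfderiv_extend
    {e : OpenPartialHomeomorph M (EuclideanHalfSpace n)}
    (he : e ∈ IsManifold.maximalAtlas (𝓡∂ n) ∞ M) {x : M} (hx : x ∈ e.source)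
    (v : TangentSpace (𝓡∂ n) x) :
    mfderivWithin 𝓘(ℝ, Coord n) (𝓡∂ n) (e.extend (𝓡∂ n)).symm (range (𝓡∂ n))
      (e.extend (𝓡∂ n) x) (differential (e.extend (𝓡∂ n)) x v) = v := by
  have h := (mdifferentiableWithinAt_extend_symm he hx).hasMFDerivWithinAt.comp x
    (mdifferentiableAt_extend he hx).hasMFDerivAt.hasMFDerivWithinAt (s := univ)
    (fun y _ => mem_range_self _)
  have h' : HasMFDerivAt (𝓡∂ n) (𝓡∂ n) id x _ :=
    (hasMFDerivWithinAt_univ.1 h).congr_of_eventuallyEq (by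
      filter_upwards [e.open_source.mem_nhds hx] with y hy
      exact (e.extend_left_inv hy).symm)
  exact congrArg (fun l => l v) (hasMFDerivAt_unique h' (hasMFDerivAt_id x))

/-- The differential of a function with a local minimum at `x` vanishes on the directions in which
one can move both forward and backward. -/
theorem mfderiv_eq_zero_of_isLocalMin
    {e : OpenPartialHomeomorph M (EuclideanHalfSpace n)}
    (he : e ∈ IsManifold.maximalAtlas (𝓡∂ n) ∞ M) {x : M} (hx : x ∈ e.source)
    {f : M → ℝ} (hf : MDifferentiableAt (𝓡∂ n) 𝓘(ℝ, ℝ) f x) (hmin : IsLocalMin f x)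
    (v : TangentSpace (𝓡∂ n) x)
    (hv : (differential (e.extend (𝓡∂ n)) x v) 0 = 0 ∨
      0 < (e.extend (𝓡∂ n) x : Coord n) 0) :
    differential f x v = 0 := by
  set u : Coord n := differential (e.extend (𝓡∂ n)) x v with hu
  set y : Coord n := e.extend (𝓡∂ n) x with hy
  have hl : (e.extend (𝓡∂ n)).symm y = x := e.extend_left_inv hx
  let l : ℝ → Coord n := fun s => y + s • u
  have hl0 : l 0 = y := by simp [l]
  have hlc : Continuous l := by fun_prop
  have hld : HasDerivAt l u 0 := by
    simpa [l] using ((hasDerivAt_id (0 : ℝ)).smul_const u).const_add y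
  have hmem : ∀ᶠ s in 𝓝 (0 : ℝ), l s ∈ range (𝓡∂ n) := by
    rw [range_modelWithCornersEuclideanHalfSpace]
    -- The coordinate line stays in the half space for small times of both signs: either coordinate
    -- `0` is constant along it, or it starts positive.
    rcases hv with hv | hv
    · refine Eventually.of_forall fun s => ?_
      have : 0 ≤ y 0 := extend_zero_nonneg e x
      simpa [l, hv] using this
    · have hc : ContinuousAt (fun s => l s 0) 0 := by fun_prop
      have : 0 < l 0 0 := by rwa [hl0]
      exact (hc.eventually (lt_mem_nhds this)).mono fun s hs => le_of_lt hs
  have hs := (mdifferentiableWithinAt_extend_symm he hx)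
  have hd : HasDerivAt ((f ∘ (e.extend (𝓡∂ n)).symm) ∘ l) (differential f x v) 0 := by
    have hf' : HasMFDerivAt (𝓡∂ n) 𝓘(ℝ, ℝ) f ((e.extend (𝓡∂ n)).symm y)
        (mfderiv (𝓡∂ n) 𝓘(ℝ, ℝ) f x) := by
      rw [hl]; exact hf.hasMFDerivAt
    let B : Coord n →L[ℝ] ℝ := (differential f x).comp (mfderivWithin 𝓘(ℝ, Coord n) (𝓡∂ n)
        (e.extend (𝓡∂ n)).symm (range (𝓡∂ n)) y)
    have h0 : HasFDerivWithinAt (f ∘ (e.extend (𝓡∂ n)).symm) B (range (𝓡∂ n)) (l 0) := by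
      rw [hl0]
      exact hasMFDerivWithinAt_iff_hasFDerivWithinAt.1
        (hf'.comp_hasMFDerivWithinAt y hs.hasMFDerivWithinAt)
    have h1 : HasDerivWithinAt ((f ∘ (e.extend (𝓡∂ n)).symm) ∘ l) (B u) (l ⁻¹' range (𝓡∂ n)) 0 :=
      h0.comp_hasDerivWithinAt 0 hld.hasDerivWithinAt (fun _ h => h)
    have h2 : B u = differential f x v :=
      congrArg (differential f x) (mfderivWithin_extend_symm_mfderiv_extend he hx v)
    exact h2 ▸ h1.hasDerivAt hmem
  refine IsLocalMin.hasDerivAt_eq_zero ?_ hd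
  have hcont : Tendsto (fun s => (e.extend (𝓡∂ n)).symm (l s)) (𝓝 0) (𝓝 x) := by
    have h1 : Tendsto (e.extend (𝓡∂ n)).symm (𝓝 y) (𝓝 x) := by
      have := e.continuousAt_extend_symm (I := 𝓡∂ n) hx
      rwa [ContinuousAt, e.extend_left_inv hx] at this
    have h2 : Tendsto l (𝓝 0) (𝓝 y) := hl0 ▸ hlc.tendsto 0
    exact h1.comp h2
  filter_upwards [hcont.eventually hmin] with s hs
  simpa only [Function.comp_apply, hl0, hl] using hs

/-! ### Velocities -/

theorem hasDerivWithinAt_comp_velocity {V : Type*} [NormedAddCommGroup V] [NormedSpace ℝ V]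
    {c : ℝ → M} {s : Set ℝ} {t : ℝ} (hc : MDifferentiableWithinAt 𝓘(ℝ, ℝ) (𝓡∂ n) c s t)
    {f : M → V} (hf : MDifferentiableAt (𝓡∂ n) 𝓘(ℝ, V) f (c t)) :
    HasDerivWithinAt (fun r => f (c r))
      (differential f (c t) (velocity (n := n) c s t)) s t := by
  have h := hf.hasMFDerivAt.comp_hasMFDerivWithinAt t hc.hasMFDerivWithinAt
  exact HasFDerivWithinAt.hasDerivWithinAt
    (f' := (differential f (c t)).comp (mfderivWithin 𝓘(ℝ, ℝ) (𝓡∂ n) c s t))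
    (hasMFDerivWithinAt_iff_hasFDerivWithinAt.1 h)

/-- A curve that is differentiable at `t` has the same velocity on both sides of `t`. -/
theorem velocity_Ici_eq_velocity_Iic {c : ℝ → M} {t : ℝ}
    (hc : MDifferentiableAt 𝓘(ℝ, ℝ) (𝓡∂ n) c t) :
    velocity (n := n) c (Ici t) t = velocity (n := n) c (Iic t) t := by
  unfold velocity
  rw [mfderivWithin_eq_mfderiv (uniqueDiffWithinAt_Ici t).uniqueMDiffWithinAt hc,
    mfderivWithin_eq_mfderiv (uniqueDiffWithinAt_Iic t).uniqueMDiffWithinAt hc]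

theorem IsDefiningFunctionAt.mdifferentiableAt {A : Set M} {ρ : M → ℝ} {x : M}
    (hρ : IsDefiningFunctionAt (n := n) A ρ x) : MDifferentiableAt (𝓡∂ n) 𝓘(ℝ, ℝ) ρ x :=
  hρ.contMDiffAt.mdifferentiableAt (by simp)

/-- The velocity of a curve in `A` that arrives at `∂A` does not point into `A`. -/
theorem IsDefiningFunctionAt.differential_velocity_Iic_nonpos {A : Set M} {c : ℝ → M}
    (hcA : ∀ r, c r ∈ A) {t : ℝ} {ρ : M → ℝ} (hρ : IsDefiningFunctionAt (n := n) A ρ (c t))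
    (hc : MDifferentiableWithinAt 𝓘(ℝ, ℝ) (𝓡∂ n) c (Iic t) t) :
    differential ρ (c t) (velocity (n := n) c (Iic t) t) ≤ 0 := by
  refine nonpos_of_hasDerivWithinAt_Iic
    (hasDerivWithinAt_comp_velocity hc hρ.mdifferentiableAt) ?_
  filter_upwards [hc.continuousWithinAt.eventually hρ.mem_iff] with r h
  rw [hρ.eq_zero]
  exact h.1 (hcA r)

/-- The velocity of a curve in `A` that departs from `∂A` does not point out of `A`. -/
theorem IsDefiningFunctionAt.differential_velocity_Ici_nonneg {A : Set M} {c : ℝ → M}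
    (hcA : ∀ r, c r ∈ A) {t : ℝ} {ρ : M → ℝ} (hρ : IsDefiningFunctionAt (n := n) A ρ (c t))
    (hc : MDifferentiableWithinAt 𝓘(ℝ, ℝ) (𝓡∂ n) c (Ici t) t) :
    0 ≤ differential ρ (c t) (velocity (n := n) c (Ici t) t) := by
  refine nonneg_of_hasDerivWithinAt_Ici
    (hasDerivWithinAt_comp_velocity hc hρ.mdifferentiableAt) ?_
  filter_upwards [hc.continuousWithinAt.eventually hρ.mem_iff] with r h
  rw [hρ.eq_zero]
  exact h.1 (hcA r)

/-! ### The metric, the boundary and its tangent vectors in arbitrary charts -/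

variable [IsManifold (𝓡∂ n) ∞ M]

theorem metricInChart_mfderiv_extend (g : RMetric n M)
    {e : OpenPartialHomeomorph M (EuclideanHalfSpace n)}
    (he : e ∈ IsManifold.maximalAtlas (𝓡∂ n) ∞ M) {x : M} (hx : x ∈ e.source)
    (v w : TangentSpace (𝓡∂ n) x) :
    metricInChart g e (e.extend (𝓡∂ n) x)
      (differential (e.extend (𝓡∂ n)) x v)
      (differential (e.extend (𝓡∂ n)) x w) = g.inner x v w := by
  unfold metricInChart
  have hv := mfderivWithin_extend_symm_mfderiv_extend he hx v
  have hw := mfderivWithin_extend_symm_mfderiv_extend he hx w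
  have hl : (e.extend (𝓡∂ n)).symm (e.extend (𝓡∂ n) x) = x := e.extend_left_inv hx
  generalize e.extend (𝓡∂ n) x = y at *
  subst hl
  exact congrArg₂ (fun a b => g.inner _ a b) hv hw

/-- Boundary points have vanishing normal coordinate in every chart. -/
theorem extend_zero_eq_zero_of_mem_boundary
    {e : OpenPartialHomeomorph M (EuclideanHalfSpace n)}
    (he : e ∈ IsManifold.maximalAtlas (𝓡∂ n) ∞ M) {x : M} (hx : x ∈ e.source)
    (hb : x ∈ (𝓡∂ n).boundary M) : (e.extend (𝓡∂ n) x : Coord n) 0 = 0 := by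
  -- If the coordinate were positive, every direction at `x` would be two-sided. Coordinate `0` of
  -- the preferred chart has its minimum, zero, at `x`, so its differential would vanish, although
  -- the differential of that chart is onto. This avoids invariance of domain.
  by_contra hne
  have hpos : 0 < (e.extend (𝓡∂ n) x : Coord n) 0 :=
    lt_of_le_of_ne (extend_zero_nonneg e x) (Ne.symm hne)
  have hb0 : (extChartAt (𝓡∂ n) x x : Coord n) 0 = 0 := by
    have h : extChartAt (𝓡∂ n) x x ∈ frontier (range (𝓡∂ n)) := hb
    rw [frontier_range_modelWithCornersEuclideanHalfSpace] at h
    exact h.symm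
  let p : Coord n →L[ℝ] ℝ := EuclideanSpace.proj 0
  have hd : HasMFDerivAt (𝓡∂ n) 𝓘(ℝ, ℝ) (p ∘ extChartAt (𝓡∂ n) x) x
      (p.comp (mfderiv (𝓡∂ n) 𝓘(ℝ, Coord n) (extChartAt (𝓡∂ n) x) x)) :=
    p.hasMFDerivAt.comp x (mdifferentiableAt_extChartAt (mem_chart_source _ x)).hasMFDerivAt
  obtain ⟨v, hv⟩ : ∃ v, mfderiv (𝓡∂ n) 𝓘(ℝ, Coord n) (extChartAt (𝓡∂ n) x) x v =
      (EuclideanSpace.single 0 1 : Coord n) :=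
    (isInvertible_mfderiv_extChartAt (mem_extChartAt_source x)).bijective.2 _
  have hmin : IsLocalMin (p ∘ extChartAt (𝓡∂ n) x) x := by
    refine Eventually.of_forall fun z => ?_
    change (extChartAt (𝓡∂ n) x x : Coord n) 0 ≤ (extChartAt (𝓡∂ n) x z : Coord n) 0
    rw [hb0]
    exact extend_zero_nonneg (chartAt _ x) z
  have h0 := mfderiv_eq_zero_of_isLocalMin he hx hd.mdifferentiableAt hmin v (Or.inr hpos)
  rw [differential, hd.mfderiv] at h0
  have h1 : p (mfderiv (𝓡∂ n) 𝓘(ℝ, Coord n) (extChartAt (𝓡∂ n) x) x v) = 0 := h0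
  rw [hv] at h1
  simp [p] at h1

/-- Vectors tangent to the boundary in one chart are so in any other. -/
theorem mfderiv_extend_zero_eq_zero
    {e e' : OpenPartialHomeomorph M (EuclideanHalfSpace n)}
    (he : e ∈ IsManifold.maximalAtlas (𝓡∂ n) ∞ M)
    (he' : e' ∈ IsManifold.maximalAtlas (𝓡∂ n) ∞ M) {x : M} (hx : x ∈ e.source)
    (hx' : x ∈ e'.source) (hb : x ∈ (𝓡∂ n).boundary M) {v : TangentSpace (𝓡∂ n) x}
    (hv : (differential (e.extend (𝓡∂ n)) x v) 0 = 0) :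
    (differential (e'.extend (𝓡∂ n)) x v) 0 = 0 := by
  let p : Coord n →L[ℝ] ℝ := EuclideanSpace.proj 0
  have hd : HasMFDerivAt (𝓡∂ n) 𝓘(ℝ, ℝ) (p ∘ e'.extend (𝓡∂ n)) x
      (p.comp (mfderiv (𝓡∂ n) 𝓘(ℝ, Coord n) (e'.extend (𝓡∂ n)) x)) :=
    p.hasMFDerivAt.comp x (mdifferentiableAt_extend he' hx').hasMFDerivAt
  -- The normal coordinate of `e'` is minimal at boundary points, so it has zero derivative in the
  -- directions that `e` sees as two-sided.
  have hmin : IsLocalMin (p ∘ e'.extend (𝓡∂ n)) x := by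
    refine Eventually.of_forall fun z => ?_
    change (e'.extend (𝓡∂ n) x : Coord n) 0 ≤ (e'.extend (𝓡∂ n) z : Coord n) 0
    rw [extend_zero_eq_zero_of_mem_boundary he' hx' hb]
    exact extend_zero_nonneg e' z
  have h0 := mfderiv_eq_zero_of_isLocalMin he hx hd.mdifferentiableAt hmin v (Or.inl hv)
  rw [differential, hd.mfderiv] at h0
  exact h0

/-- Tangency is defined by the preferred chart; this allows it to be tested in boundary normal
coordinates. -/
theorem isTangentToBoundary_iff
    {e : OpenPartialHomeomorph M (EuclideanHalfSpace n)}
    (he : e ∈ IsManifold.maximalAtlas (𝓡∂ n) ∞ M) {x : M} (hx : x ∈ e.source)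
    (hb : x ∈ (𝓡∂ n).boundary M) (v : TangentSpace (𝓡∂ n) x) :
    IsTangentToBoundary x v ↔
      (differential (e.extend (𝓡∂ n)) x v) 0 = 0 := by
  have hc : chartAt (EuclideanHalfSpace n) x ∈ IsManifold.maximalAtlas (𝓡∂ n) ∞ M :=
    IsManifold.chart_mem_maximalAtlas x
  exact ⟨mfderiv_extend_zero_eq_zero hc he (mem_chart_source _ x) hx hb,
    mfderiv_extend_zero_eq_zero he hc hx (mem_chart_source _ x) hb⟩

theorem IsGeodesicOn.mdifferentiableWithinAt_Ici {g : RMetric n M} {c : ℝ → M} {t ε : ℝ}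
    (hε : 0 < ε) (h : IsGeodesicOn g c (Icc t (t + ε))) :
    MDifferentiableWithinAt 𝓘(ℝ, ℝ) (𝓡∂ n) c (Ici t) t :=
  (h.1.mdifferentiableOn (by simp) t ⟨le_rfl, by linarith⟩).mono_of_mem_nhdsWithin
    (Icc_mem_nhdsGE (by linarith))

theorem IsGeodesicOn.mdifferentiableWithinAt_Iic {g : RMetric n M} {c : ℝ → M} {t ε : ℝ}
    (hε : 0 < ε) (h : IsGeodesicOn g c (Icc (t - ε) t)) :
    MDifferentiableWithinAt 𝓘(ℝ, ℝ) (𝓡∂ n) c (Iic t) t :=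
  (h.1.mdifferentiableOn (by simp) t ⟨by linarith, le_rfl⟩).mono_of_mem_nhdsWithin
    (Icc_mem_nhdsLE (by linarith))

end Charts

/-! ### The sign change of the normal coordinate -/

section Flip

variable {n : ℕ} [NeZero n]

/-- The change of coordinates on the copy `i` of the double: on the second copy the sign of the
coordinate `0` is changed. -/
noncomputable def flip (i : Bool) : Coord n →L[ℝ] Coord n :=
  if i then ContinuousLinearMap.id ℝ _ -
    ((2 : ℝ) • (EuclideanSpace.proj 0 : Coord n →L[ℝ] ℝ)).smulRight (EuclideanSpace.single 0 1)
  else ContinuousLinearMap.id ℝ _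

theorem flip_true_apply (y : Coord n) :
    flip true y = y - (2 * y 0) • EuclideanSpace.single 0 1 := by
  simp [flip]

theorem flip_false_apply (y : Coord n) : flip false y = y := by simp [flip]

theorem flip_zero (i : Bool) (y : Coord n) : flip i y 0 = if i then - y 0 else y 0 := by
  cases i
  · simp [flip_false_apply]
  · simp [flip_true_apply]; ring

theorem flip_apply_of_ne_zero (i : Bool) (y : Coord n) {k : Fin n} (hk : k ≠ 0) :
    flip i y k = y k := by
  cases i <;> simp [flip_true_apply, flip_false_apply, hk]

/-- Two vectors, the first pointing out of the half space and the second into it, which agree after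
sign changes of the coordinate `0`, are mirror images of each other. -/
theorem mirror_of_flip_eq {i j : Bool} {a b : Coord n} (h : flip i a = flip j b) (ha : a 0 ≤ 0)
    (hb : 0 ≤ b 0) : (a + b) 0 = 0 ∧ b - a = (b 0 - a 0) • EuclideanSpace.single 0 1 := by
  constructor
  · have h0 := congrArg (fun z : Coord n => z 0) h
    simp only [flip_zero] at h0
    rw [PiLp.add_apply]
    -- On different copies the normal components are opposite; on the same copy they are equal, and
    -- the sign conditions make both zero (a tangential touch).
    cases i <;> cases j <;> simp at h0 <;> linarith
  · ext k
    by_cases hk : k = 0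
    · subst hk; simp
    · have hk' := congrArg (fun z : Coord n => z k) h
      simp only [flip_apply_of_ne_zero _ _ hk] at hk'
      simp [hk, hk']

end Flip

/-! ### Projections of geodesics of the double -/

section Rays

variable {n : ℕ} [NeZero n] {M : Type*} [TopologicalSpace M]
  [ChartedSpace (EuclideanHalfSpace n) M] [IsManifold (𝓡∂ n) ∞ M]

/-- The only conflict is a point lying in both copies. It belongs to the closure of R, hence to the
closed set ∂M, where the normal coordinate is zero and the sign change has no effect. -/
theorem doubleCoord_of_mem_range_copy {A : Set M}
    {e : OpenPartialHomeomorph M (EuclideanHalfSpace n)}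
    (he : e ∈ IsManifold.maximalAtlas (𝓡∂ n) ∞ M) {i : Bool} {q : Double n A}
    (hq : q ∈ range (copy n A i)) (hs : (proj n A q : M) ∈ e.source) :
    doubleCoord e q = flip i (e.extend (𝓡∂ n) (proj n A q : M)) := by
  cases i
  · rw [flip_false_apply]
    unfold doubleCoord
    split_ifs with h
    · obtain ⟨x, rfl⟩ := hq
      obtain ⟨y, hy⟩ := h
      obtain ⟨hyx, h | h⟩ := Quotient.exact hy
      · cases h
      · dsimp only at hyx h
        subst hyx
        have hb : (y : M) ∈ (𝓡∂ n).boundary M :=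
          (closure_minimal inter_subset_left
            ((𝓡∂ n).isClosed_boundary (n := ∞) (by simp))) h
        have h0 := extend_zero_eq_zero_of_mem_boundary he (x := (y : M)) hs hb
        change (e.extend (𝓡∂ n) (y : M) : Coord n) - _ = e.extend (𝓡∂ n) (y : M)
        change _ - (2 * (e.extend (𝓡∂ n) (y : M) : Coord n) 0) • _ = _
        rw [h0, mul_zero, zero_smul, sub_zero]
    · rfl
  · rw [flip_true_apply]
    simp only [doubleCoord, if_pos hq]

/-- In boundary normal coordinates, vectors that are mirror images of each other obey the law of
reflection in the tangent space of the boundary. -/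
theorem reflectionLaw_of_mirror (g : RMetric n M)
    {e : OpenPartialHomeomorph M (EuclideanHalfSpace n)} (he : IsBoundaryNormalChart g e) {x : M}
    (hx : x ∈ e.source) (hb : x ∈ (𝓡∂ n).boundary M) {v v' : TangentSpace (𝓡∂ n) x} {k : ℝ}
    (hadd : (differential (e.extend (𝓡∂ n)) x v + differential (e.extend (𝓡∂ n)) x v') 0 = 0)
    (hsub : differential (e.extend (𝓡∂ n)) x v' - differential (e.extend (𝓡∂ n)) x v =
      k • EuclideanSpace.single 0 1) :
    ReflectionLaw g (IsTangentToBoundary x) v v' := by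
  refine ⟨?_, fun w hw => ?_⟩
  · rw [isTangentToBoundary_iff he.1 hx hb, map_add]
    exact hadd
  · rw [isTangentToBoundary_iff he.1 hx hb] at hw
    rw [← metricInChart_mfderiv_extend g he.1 hx, map_sub, hsub]
    have hlin : ∀ z u w : Coord n, metricInChart g e z (k • u) w = k * metricInChart g e z u w := by
      intro z u w
      simp only [metricInChart]
      erw [map_smul, map_smul]
      rfl
    -- In normal coordinates the inner product of the basis vector `0` with `w` is `w 0`, which
    -- vanishes for tangent `w`.
    rw [hlin, he.2 _ ((e.extend (𝓡∂ n)).map_source (by rwa [e.extend_source])), hw, mul_zero]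

variable {g : RMetric n M} {A : Set M} {L : ℝ} {φ : ℝ → Double n A}

/-- A geodesic of the double that crosses or touches the seam is reflected by `∂M` after
projection. -/
theorem reflectionLaw_boundary {t : ℝ} {i j : Bool}
    (hi : ∀ᶠ r in 𝓝[≤] t, φ r ∈ range (copy n A i))
    (hj : ∀ᶠ r in 𝓝[≥] t, φ r ∈ range (copy n A j))
    (hl : MDifferentiableWithinAt 𝓘(ℝ, ℝ) (𝓡∂ n) (fun r => (proj n A (φ r) : M)) (Iic t) t)
    (hr : MDifferentiableWithinAt 𝓘(ℝ, ℝ) (𝓡∂ n) (fun r => (proj n A (φ r) : M)) (Ici t) t)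
    (hc : IsC1At g φ t) (hb : (proj n A (φ t) : M) ∈ (𝓡∂ n).boundary M) :
    ReflectionLaw g (IsTangentToBoundary (proj n A (φ t) : M))
      (velocity (n := n) (fun r => (proj n A (φ r) : M)) (Iic t) t)
      (velocity (n := n) (fun r => (proj n A (φ r) : M)) (Ici t) t) := by
  obtain ⟨e, he, hx, hd⟩ := hc.2 hb
  have hd := (hd.differentiableAt (by simp)).hasDerivAt
  have hx0 := extend_zero_eq_zero_of_mem_boundary he.1 hx hb
  have hE := mdifferentiableAt_extend he.1 hx
  have hL := hasDerivWithinAt_comp_velocity hl hE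
  have hR := hasDerivWithinAt_comp_velocity hr hE
  have hsL := hl.continuousWithinAt.eventually (e.open_source.mem_nhds hx)
  have hsR := hr.continuousWithinAt.eventually (e.open_source.mem_nhds hx)
  have hDL := ((flip i).hasFDerivAt.comp_hasDerivWithinAt t hL).congr_of_eventuallyEq
    (f₁ := fun r => doubleCoord e (φ r))
    (by filter_upwards [hi, hsL] with r h1 h2 using doubleCoord_of_mem_range_copy he.1 h1 h2)
    (doubleCoord_of_mem_range_copy he.1 (hi.self_of_nhdsWithin (mem_Iic.2 le_rfl)) hx)
  have hDR := ((flip j).hasFDerivAt.comp_hasDerivWithinAt t hR).congr_of_eventuallyEq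
    (f₁ := fun r => doubleCoord e (φ r))
    (by filter_upwards [hj, hsR] with r h1 h2 using doubleCoord_of_mem_range_copy he.1 h1 h2)
    (doubleCoord_of_mem_range_copy he.1 (hj.self_of_nhdsWithin (mem_Ici.2 le_rfl)) hx)
  -- Both one-sided derivatives equal the derivative of the doubled coordinates at `t`.
  have hEq := ((uniqueDiffWithinAt_Iic t).eq_deriv _ hDL hd.hasDerivWithinAt).trans
    ((uniqueDiffWithinAt_Ici t).eq_deriv _ hDR hd.hasDerivWithinAt).symm
  let p : Coord n →L[ℝ] ℝ := EuclideanSpace.proj 0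
  have hmin : ∀ r, p (e.extend (𝓡∂ n) (proj n A (φ t) : M)) ≤
      p (e.extend (𝓡∂ n) (proj n A (φ r) : M)) := fun r => by
    change (e.extend (𝓡∂ n) (proj n A (φ t) : M) : Coord n) 0 ≤ _
    rw [hx0]
    exact extend_zero_nonneg e _
  have hn := nonpos_of_hasDerivWithinAt_Iic (p.hasFDerivAt.comp_hasDerivWithinAt t hL)
    (Eventually.of_forall hmin)
  have hp := nonneg_of_hasDerivWithinAt_Ici (p.hasFDerivAt.comp_hasDerivWithinAt t hR)
    (Eventually.of_forall hmin)
  obtain ⟨h1, h2⟩ := mirror_of_flip_eq hEq hn hp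
  exact reflectionLaw_of_mirror g he hx hb h1 h2

/-- The projection of a geodesic of the double is a broken ray. -/
theorem IsDoubleGeodesic.isBrokenRay_proj (hA : IsReflectable g A)
    (hφ : IsDoubleGeodesic g A L φ) : IsBrokenRay g A L (fun r => proj n A (φ r)) where
  pos := hφ.pos
  start_mem := hφ.start_mem
  end_mem := hφ.end_mem
  geodesic_right t ht := by
    obtain ⟨ε, hε, hL, h⟩ := hφ.geodesic_right t ht
    exact ⟨ε, hε, hL, h.2⟩
  geodesic_left t ht := by
    obtain ⟨ε, hε, hL, h⟩ := hφ.geodesic_left t ht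
    exact ⟨ε, hε, hL, h.2⟩
  reflection t ht := by
    obtain ⟨ε, hε, -, ⟨i, hi⟩, hgl⟩ := hφ.geodesic_left t ⟨ht.1, ht.2.le⟩
    obtain ⟨δ, hδ, -, ⟨j, hj⟩, hgr⟩ := hφ.geodesic_right t ⟨ht.1.le, ht.2⟩
    have hl := hgl.mdifferentiableWithinAt_Iic hε
    have hr := hgr.mdifferentiableWithinAt_Ici hδ
    have hB : (proj n A (φ t) : M) ∈ (𝓡∂ n).boundary M →
        ReflectionLaw g (IsTangentToBoundary (proj n A (φ t) : M))
          (velocity (n := n) (fun r => (proj n A (φ r) : M)) (Iic t) t)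
          (velocity (n := n) (fun r => (proj n A (φ r) : M)) (Ici t) t) :=
      reflectionLaw_boundary (mem_of_superset (Icc_mem_nhdsLE (by linarith)) hi)
        (mem_of_superset (Icc_mem_nhdsGE (by linarith)) hj) hl hr (hφ.c1 t ht)
    have hI : (proj n A (φ t) : M) ∉ (𝓡∂ n).boundary M →
        velocity (n := n) (fun r => (proj n A (φ r) : M)) (Ici t) t =
          velocity (n := n) (fun r => (proj n A (φ r) : M)) (Iic t) t := fun hb =>
      velocity_Ici_eq_velocity_Iic (((hφ.c1 t ht).1 hb).mdifferentiableAt (by simp))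
    -- The intermediate velocity is already the outgoing one: ∂M does all the reflecting, and ∂A
    -- must be shown to do none.
    refine ⟨velocity (n := n) (fun r => (proj n A (φ r) : M)) (Ici t) t, ?_, ?_⟩
    · split_ifs with hb
      · exact hB hb
      · exact hI hb
    · split_ifs with hf
      · obtain ⟨ρ, hρ, hν⟩ := hA.smooth_orthogonal _ hf
        have hin := hρ.differential_velocity_Iic_nonpos
          (c := fun r => (proj n A (φ r) : M)) (fun r => (proj n A (φ r)).2) hl
        have hout := hρ.differential_velocity_Ici_nonneg
          (c := fun r => (proj n A (φ r) : M)) (fun r => (proj n A (φ r)).2) hr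
        have heq : differential ρ (proj n A (φ t) : M)
            (velocity (n := n) (fun r => (proj n A (φ r) : M)) (Ici t) t) =
            differential ρ (proj n A (φ t) : M)
              (velocity (n := n) (fun r => (proj n A (φ r) : M)) (Iic t) t) := by
          by_cases hb : (proj n A (φ t) : M) ∈ (𝓡∂ n).boundary M
          -- At a corner the jump of the velocity is normal to ∂M, hence in the kernel of dρ.
          · rw [← sub_eq_zero, ← map_sub]
            exact hν hb _ (hB hb).2
          · rw [hI hb]
        have h0 : differential ρ (proj n A (φ t) : M)
            (velocity (n := n) (fun r => (proj n A (φ r) : M)) (Ici t) t) = 0 :=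
          le_antisymm (heq.trans_le hin) hout
        refine ⟨ρ, hρ, ?_, fun w _ => by simp⟩
        change differential ρ (proj n A (φ t) : M) (_ + _) = 0
        rw [map_add, h0, add_zero]
      · rfl

end Rays

/-! ### The transforms -/

section Transforms

variable {n : ℕ} [NeZero n] {M : Type*} [TopologicalSpace M]
  [ChartedSpace (EuclideanHalfSpace n) M]

/-- The first copy is a section of the projection. -/
theorem reflect_injective (A : Set M) :
    Function.Injective (reflect n : (A → ℝ) → Double n A → ℝ) := by
  intro f f' h
  funext x
  exact congrFun h (copy n A false x)

variable [IsManifold (𝓡∂ n) ∞ M]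

/-- The broken ray transform determines the geodesic ray transform of the reflected functions. -/
theorem geodesicRayTransform_reflect_eq {g : RMetric n M} {A : Set M} (hA : IsReflectable g A)
    {h f h' f' : A → ℝ} (heq : brokenRayTransform g A h f = brokenRayTransform g A h' f') :
    geodesicRayTransform g A (reflect n h) (reflect n f) =
      geodesicRayTransform g A (reflect n h') (reflect n f') := by
  funext γ
  -- Both sides unfold to the same integral along the projected curve, so no integrability is
  -- required.
  exact congrFun heq ⟨(γ.1.1, fun r => proj n A (γ.1.2 r)), γ.2.isBrokenRay_proj hA⟩

end Transforms

end BrokenRay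

open BrokenRay in
theorem theorem4p5 {n : ℕ} [NeZero n] {M : Type*} [TopologicalSpace M] [T2Space M]
    [CompactSpace M] [ChartedSpace (EuclideanHalfSpace n) M] [IsManifold (𝓡∂ n) ∞ M]
    (g : RMetric n M) (A : Set M) (hA : IsReflectable g A) (F H : Set (A → ℝ)) :
    -- unknown attenuation
    (InjOn (fun p : (Double n A → ℝ) × (Double n A → ℝ) => geodesicRayTransform g A p.1 p.2)
        (reflectClass n H ×ˢ reflectClass n F) →
      InjOn (fun p : (A → ℝ) × (A → ℝ) => brokenRayTransform g A p.1 p.2) (H ×ˢ F)) ∧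
    -- known attenuation
    (∀ h ∈ H,
      InjOn (fun f : Double n A → ℝ => geodesicRayTransform g A (reflect n h) f)
        (reflectClass n F) →
      InjOn (fun f : A → ℝ => brokenRayTransform g A h f) F) := by
  constructor
  · rintro hinj ⟨h, f⟩ ⟨hh, hf⟩ ⟨h', f'⟩ ⟨hh', hf'⟩ heq
    have key := hinj (x₁ := (reflect n h, reflect n f))
      ⟨mem_image_of_mem _ hh, mem_image_of_mem _ hf⟩ (x₂ := (reflect n h', reflect n f'))
      ⟨mem_image_of_mem _ hh', mem_image_of_mem _ hf'⟩ (geodesicRayTransform_reflect_eq hA heq)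
    exact Prod.ext (reflect_injective A (Prod.ext_iff.1 key).1)
      (reflect_injective A (Prod.ext_iff.1 key).2)
  · intro h _ hinj f hf f' hf' heq
    exact reflect_injective A (hinj (mem_image_of_mem _ hf) (mem_image_of_mem _ hf')
      (geodesicRayTransform_reflect_eq hA heq))
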